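/- Let $\mathcal H_1,\mathcal H_2$ be complex Hilbert spaces, $A_1,A_2$ (possibly unbounded) self-adjoint operators in them, $B_{12}:\mathcal H_2\to\mathcal H_1$ a bounded operator and $B_{21}=B_{12}^*$. Let $$\mathbf H=\begin{pmatrix}A_1&B_{12}\\B_{21}&A_2\end{pmatrix},\qquad \mathcal D(\mathbf H)=\mathcal D(A_1)\oplus\mathcal D(A_2),$$ in $\mathcal H_1\oplus\mathcal H_2$. Let $Q_{21}:\mathcal H_1\to\mathcal H_2$ be a bounded solution of the Riccati equation $$Q_{21}A_1-A_2Q_{21}+Q_{21}B_{12}Q_{21}=B_{21}\quad\text{on }\mathcal D(A_1)$$ (in particular $Q_{21}\mathcal D(A_1)\subseteq\mathcal D(A_2)$), let $Q_{12}=-Q_{21}^*$, and let $H_1=A_1+B_{12}Q_{21}$ and $H_2=A_2+B_{21}Q_{12}$, with domains $\mathcal D(A_1)$ and $\mathcal D(A_2)$. Suppose that for $(\alpha,\beta)=(1,2)$ and $(2,1)$ there is a constant $C_{\alpha\beta}>0$ such that $(H_\alpha-\mu)^{-1}$ exists as a bounded operator and $$\|(H_\alpha-\mu)^{-1}\|\le\frac{C_{\alpha\beta}}{1+|\mu|}\qquad\text{for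 all }\mu\in\sigma(A_\beta).$$ Let $\mathcal U_\alpha^d$ be the set of those eigenvectors $U=\{u_1,u_2\}$ of $\mathbf H$, $\mathbf HU=zU$, whose component $u_\alpha$ is an eigenvector of $H_\alpha$ for the same eigenvalue: $u_\alpha\ne0$, $H_\alpha u_\alpha=zu_\alpha$. Then: 1. Let $\{\alpha,\beta\}=\{1,2\}$ and $\mathbf HU=zU$, $U=\{u_1,u_2\}\neq0$. If $u_\alpha$ is an eigenvector of $H_\alpha$ with eigenvalue $z$, then $u_\beta$ is not an eigenvector of $H_\beta$ with eigenvalue $z$. 2. $\mathcal U_1^d\cap\mathcal U_2^d=\emptyset$. 3. The two sets cover the discrete eigenvectors of $\mathbf H$ in the following sense: there is an orthonormal system $\mathcal U^d\subseteq\mathcal U_1^d\cup\mathcal U_2^d$ of eigenvectors of $\mathbf H$ whose closed linear span contains every eigenvector of $\mathbf H$; moreover, every eigenvector of $\mathbf H$ whose eigenvalue is not a common eigenvalue of $H_1$ and $H_2$ lies in $\mathcal U_1^d\cup\mathcal U_2^d$. -/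

import Mathlib

namespace TwoChannel

/-- `u` is an eigenvector of the (possibly unbounded) operator `T` with eigenvalue `z`. -/
def IsEigenvector {E : Type*} [AddCommGroup E] [Module ℂ E]
    (T : E →ₗ.[ℂ] E) (z : ℂ) (u : E) : Prop :=
  u ≠ 0 ∧ ∃ hu : u ∈ T.domain, T ⟨u, hu⟩ = z • u

/-- The set of eigenvalues of `T` (the discrete spectrum, in the sense in which the complement of
the continuous part of a self-adjoint operator is spanned by eigenvectors; the eigenvalues need
not be isolated and may have any multiplicity). -/
def eigenvalues {E : Type*} [AddCommGroup E] [Module ℂ E] (T : E →ₗ.[ℂ] E) : Set ℂ :=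
  {z | ∃ u, IsEigenvector T z u}

section Resolvent

variable {E : Type*} [NormedAddCommGroup E] [NormedSpace ℂ E]

/-- The bounded operator `R` is the inverse `(T - μ)⁻¹` of `T - μ : T.domain → E`. -/
def IsResolvent (T : E →ₗ.[ℂ] E) (μ : ℂ) (R : E →L[ℂ] E) : Prop :=
  (∀ f : E, ∃ hf : R f ∈ T.domain, T ⟨R f, hf⟩ - μ • R f = f) ∧
    ∀ f : T.domain, R (T f - μ • (f : E)) = f

/-- The spectrum of an unbounded operator. -/
def unboundedSpectrum (T : E →ₗ.[ℂ] E) : Set ℂ :=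
  {μ | ¬ ∃ R : E →L[ℂ] E, IsResolvent T μ R}

/-- For some constant `C`, the bound `‖(T - μ)⁻¹‖ ≤ C / (1 + |μ|)` holds at every `μ ∈ S`; in
particular the inverse exists there. -/
def ResolventBound (T : E →ₗ.[ℂ] E) (S : Set ℂ) : Prop :=
  ∃ C : ℝ, 0 < C ∧ ∀ μ ∈ S, ∃ R : E →L[ℂ] E, IsResolvent T μ R ∧ ‖R‖ ≤ C / (1 + ‖μ‖)

/-- The operator `A + W` on the domain of `A`, for a bounded operator `W`. -/
def addBounded (A : E →ₗ.[ℂ] E) (W : E →L[ℂ] E) : E →ₗ.[ℂ] E where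
  domain := A.domain
  toFun := A.toFun + (W : E →ₗ[ℂ] E) ∘ₗ A.domain.subtype

end Resolvent

section Channels

variable {E₁ E₂ : Type*} [NormedAddCommGroup E₁] [InnerProductSpace ℂ E₁]
  [NormedAddCommGroup E₂] [InnerProductSpace ℂ E₂]

/-- The total Hamiltonian `(u₁, u₂) ↦ (A₁ u₁ + B₁₂ u₂, B₂₁ u₁ + A₂ u₂)` with domain
`D(A₁) ⊕ D(A₂)` in the Hilbert space direct sum of the two channel spaces. -/
def totalHamiltonian (A₁ : E₁ →ₗ.[ℂ] E₁) (A₂ : E₂ →ₗ.[ℂ] E₂)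
    (B₁₂ : E₂ →L[ℂ] E₁) (B₂₁ : E₁ →L[ℂ] E₂) :
    WithLp 2 (E₁ × E₂) →ₗ.[ℂ] WithLp 2 (E₁ × E₂) where
  domain :=
    { carrier := {U | U.fst ∈ A₁.domain ∧ U.snd ∈ A₂.domain}
      add_mem' := fun hU hV => ⟨A₁.domain.add_mem hU.1 hV.1, A₂.domain.add_mem hU.2 hV.2⟩
      zero_mem' := ⟨A₁.domain.zero_mem, A₂.domain.zero_mem⟩
      smul_mem' := fun c _ hU => ⟨A₁.domain.smul_mem c hU.1, A₂.domain.smul_mem c hU.2⟩ }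
  toFun :=
    { toFun := fun U => WithLp.toLp 2
        (A₁ ⟨(U : WithLp 2 (E₁ × E₂)).fst, U.2.1⟩ + B₁₂ (U : WithLp 2 (E₁ × E₂)).snd,
          B₂₁ (U : WithLp 2 (E₁ × E₂)).fst + A₂ ⟨(U : WithLp 2 (E₁ × E₂)).snd, U.2.2⟩)
      map_add' := by
        intro U V
        have h1 := A₁.map_add ⟨_, U.2.1⟩ ⟨_, V.2.1⟩
        have h2 := A₂.map_add ⟨_, U.2.2⟩ ⟨_, V.2.2⟩
        rw [← WithLp.toLp_add]
        congr 1
        ext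
        · refine (congrArg₂ (· + ·) h1 (B₁₂.map_add _ _)).trans ?_
          exact add_add_add_comm _ _ _ _
        · refine (congrArg₂ (· + ·) (B₂₁.map_add _ _) h2).trans ?_
          exact add_add_add_comm _ _ _ _
      map_smul' := by
        intro c U
        have h1 := A₁.map_smul c ⟨_, U.2.1⟩
        have h2 := A₂.map_smul c ⟨_, U.2.2⟩
        rw [RingHom.id_apply, ← WithLp.toLp_smul]
        congr 1
        ext
        · refine (congrArg₂ (· + ·) h1 (B₁₂.map_smul _ _)).trans ?_
          exact (smul_add _ _ _).symm
        · refine (congrArg₂ (· + ·) (B₂₁.map_smul _ _) h2).trans ?_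
          exact (smul_add _ _ _).symm }

/-- `Q₂₁` is a bounded solution of the stationary Riccati equation
`Q₂₁ A₁ - A₂ Q₂₁ + Q₂₁ B₁₂ Q₂₁ = B₂₁`, an equality of operators on `D(A₁)`; in particular
`Q₂₁` maps `D(A₁)` into `D(A₂)`. -/
def IsRiccatiSolution (A₁ : E₁ →ₗ.[ℂ] E₁) (A₂ : E₂ →ₗ.[ℂ] E₂)
    (B₁₂ : E₂ →L[ℂ] E₁) (B₂₁ Q₂₁ : E₁ →L[ℂ] E₂) : Prop :=
  ∀ f : A₁.domain, ∃ hf : Q₂₁ f ∈ A₂.domain,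
    Q₂₁ (A₁ f) - A₂ ⟨Q₂₁ f, hf⟩ + Q₂₁ (B₁₂ (Q₂₁ f)) = B₂₁ f

/-- The channel Hamiltonian `H = A + B Q` with domain `D(A)`. -/
def channelHamiltonian (A : E₁ →ₗ.[ℂ] E₁) (B : E₂ →L[ℂ] E₁) (Q : E₁ →L[ℂ] E₂) :
    E₁ →ₗ.[ℂ] E₁ :=
  addBounded A (B.comp Q)

/-- The eigenvectors `U = {u₁, u₂}` of `H` whose component `u₁` is an eigenvector of `H₁`
for the same eigenvalue. -/
def eigenvectorSet₁ (H : WithLp 2 (E₁ × E₂) →ₗ.[ℂ] WithLp 2 (E₁ × E₂)) (H₁ : E₁ →ₗ.[ℂ] E₁) :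
    Set (WithLp 2 (E₁ × E₂)) :=
  {U | ∃ z, IsEigenvector H z U ∧ IsEigenvector H₁ z U.fst}

/-- The eigenvectors `U = {u₁, u₂}` of `H` whose component `u₂` is an eigenvector of `H₂`
for the same eigenvalue. -/
def eigenvectorSet₂ (H : WithLp 2 (E₁ × E₂) →ₗ.[ℂ] WithLp 2 (E₁ × E₂)) (H₂ : E₂ →ₗ.[ℂ] E₂) :
    Set (WithLp 2 (E₁ × E₂)) :=
  {U | ∃ z, IsEigenvector H z U ∧ IsEigenvector H₂ z U.snd}

end Channels

/-- `𝒰` is a complete orthonormal system of eigenvectors of `H`: it is orthonormal, its members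
are eigenvectors, and every eigenvector lies in its closed linear span. -/
def IsCompleteEigensystem {E : Type*} [NormedAddCommGroup E] [InnerProductSpace ℂ E]
    (H : E →ₗ.[ℂ] E) (𝒰 : Set E) : Prop :=
  Orthonormal ℂ (Subtype.val : 𝒰 → E) ∧
    (∀ U ∈ 𝒰, ∃ z, IsEigenvector H z U) ∧
    ∀ z U, IsEigenvector H z U → U ∈ (Submodule.span ℂ 𝒰).topologicalClosure

end TwoChannel

/-!
A self-adjoint operator is handled through its graph, a subspace `g` with `g.adjoint = g`. Let `G`
be the graph of `Q₂₁`, a closed subspace of the direct sum, so that `Gᗮ` is the set of pairs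
`(Q₁₂ y, y)`.

The Riccati equation says that the total Hamiltonian leaves `G` invariant and acts on it as
`(x, Q₂₁ x) ↦ (H₁ x, Q₂₁ H₁ x)`. Its adjoint is the Riccati equation for `Q₁₂`
(`IsRiccatiSolution.dual`), so `Gᗮ` is invariant as well, with `H₂` acting there. Hence eigenvectors
lying in `G` belong to `eigenvectorSet₁`, and those in `Gᗮ` to `eigenvectorSet₂`.

Conversely, if `u₁` is an eigenvector of `H₁` for `z`, then `u₂ - Q₂₁ u₁` satisfies
`A₂ y = z y`; were it nonzero, `z` would be in the spectrum of `A₂`, where `H₁ - z` is invertible by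
the resolvent bound, contradicting `H₁ u₁ = z u₁`. So `(u₁, u₂) ∈ G`
(`IsRiccatiSolution.snd_eq_of_isEigenvector`), and by symmetry `(u₁, u₂) ∈ Gᗮ` if `u₂` is an
eigenvector of `H₂`. As `G ⊓ Gᗮ = ⊥`, both cannot happen for a nonzero vector.

For completeness, every eigenvector is the sum of its projections to `G` and `Gᗮ`, and these are
again in the eigenspace (`IsRiccatiSolution.exists_add_eq_of_mem_eigenspace`). The delicate point is
that the projections lie in the domain; this follows since `H₁ - iM` and `H₂ - iM` are onto for
large `M` (`exists_mem_add_sub_eq`). The eigenspaces are closed and mutually orthogonal, so Hilbert bases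
of their intersections with `G` and with `Gᗮ` unite to the required orthonormal system. If both
projections of an eigenvector are nonzero, its eigenvalue is common to `H₁` and `H₂`.
-/

namespace TwoChannel

open scoped InnerProductSpace

/-! ### Self-adjoint relations -/

section Relation

variable {E : Type*} [NormedAddCommGroup E] [InnerProductSpace ℂ E]
  {g : Submodule ℂ (E × E)}

theorem mem_iff_of_adjoint_eq (hg : g.adjoint = g) (u w : E) :
    (u, w) ∈ g ↔ ∀ a b, (a, b) ∈ g → ⟪b, u⟫_ℂ = ⟪a, w⟫_ℂ := by
  nth_rw 1 [← hg]
  simp [sub_eq_zero]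

theorem inner_eq_of_adjoint_eq (hg : g.adjoint = g) {u w a b : E} (h : (u, w) ∈ g)
    (h' : (a, b) ∈ g) : ⟪b, u⟫_ℂ = ⟪a, w⟫_ℂ :=
  (mem_iff_of_adjoint_eq hg u w).1 h a b h'

theorem isClosed_of_adjoint_eq (hg : g.adjoint = g) : IsClosed (g : Set (E × E)) := by
  have : (g : Set (E × E)) = ⋂ p : g, {q | ⟪(p : E × E).2, q.1⟫_ℂ = ⟪(p : E × E).1, q.2⟫_ℂ} := by
    ext ⟨u, w⟩
    simp [mem_iff_of_adjoint_eq hg u w]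
  rw [this]
  exact isClosed_iInter fun p => isClosed_eq (by fun_prop) (by fun_prop)

/-- Off the real axis a symmetric operator is bounded below: the imaginary part of
`⟪u, (T - iM) u⟫` is `-M ‖u‖²`. -/
theorem mul_norm_le_norm_sub (hg : g.adjoint = g) {u w : E} (h : (u, w) ∈ g) (M : ℝ) :
    |M| * ‖u‖ ≤ ‖w - (M * Complex.I) • u‖ := by
  have hre : (⟪u, w⟫_ℂ).im = 0 := by
    have h1 := inner_eq_of_adjoint_eq hg h h
    rw [← inner_conj_symm] at h1
    exact Complex.conj_eq_iff_im.1 h1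
  have h2 : (⟪u, w - (M * Complex.I) • u⟫_ℂ).im = -(M * ‖u‖ ^ 2) := by
    rw [inner_sub_right, inner_smul_right, inner_self_eq_norm_sq_to_K, Complex.sub_im, hre]
    simp [← Complex.ofReal_pow]
  have h3 : |M| * ‖u‖ ^ 2 ≤ ‖u‖ * ‖w - (M * Complex.I) • u‖ :=
    calc |M| * ‖u‖ ^ 2 = |(⟪u, w - (M * Complex.I) • u⟫_ℂ).im| := by
          rw [h2, abs_neg, abs_mul, abs_of_nonneg (sq_nonneg ‖u‖)]
      _ ≤ ‖⟪u, w - (M * Complex.I) • u⟫_ℂ‖ := Complex.abs_im_le_norm _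
      _ ≤ _ := norm_inner_le_norm _ _
  rcases (norm_nonneg u).eq_or_lt with h0 | h0
  · rw [← h0, mul_zero]; exact norm_nonneg _
  · refine le_of_mul_le_mul_left ?_ h0
    linarith [h3, (by ring : ‖u‖ * (|M| * ‖u‖) = |M| * ‖u‖ ^ 2)]

theorem mul_norm_le_norm_add_sub (hg : g.adjoint = g) (W : E →L[ℂ] E) {u w : E}
    (h : (u, w) ∈ g) (M : ℝ) :
    (|M| - ‖W‖) * ‖u‖ ≤ ‖w + W u - (M * Complex.I) • u‖ := by
  have h1 := mul_norm_le_norm_sub hg h M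
  have h2 : ‖w - (M * Complex.I) • u‖ ≤ ‖w + W u - (M * Complex.I) • u‖ + ‖W u‖ := by
    rw [show w - (M * Complex.I) • u = w + W u - (M * Complex.I) • u - W u by abel]
    exact norm_sub_le _ _
  linarith [W.le_opNorm u]

/-- For a self-adjoint `T` and a bounded `W`, the operator `T + W - iM` is onto once `‖W‖ < M`:
it is bounded below, so its range is closed, and so is its adjoint `T + W* + iM`, so that the range
is dense. -/
theorem exists_mem_add_sub_eq [CompleteSpace E] (hg : g.adjoint = g) (W : E →L[ℂ] E) {M : ℝ}
    (hM : ‖W‖ < M) (f : E) :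
    ∃ u w, (u, w) ∈ g ∧ w + W u - (M * Complex.I) • u = f := by
  have hM0 : 0 < M := (norm_nonneg W).trans_lt hM
  have hc : 0 < M - ‖W‖ := sub_pos.2 hM
  let K : E × E →L[ℂ] E :=
    ContinuousLinearMap.snd ℂ E E + (W - (M * Complex.I) • ContinuousLinearMap.id ℂ E) ∘L
      ContinuousLinearMap.fst ℂ E E
  have hK : ∀ p : E × E, K p = p.2 + W p.1 - (M * Complex.I) • p.1 := fun p => by
    simp [K, add_sub_assoc]
  let L : g →L[ℂ] E := K ∘L g.subtypeL
  have hLK : ∀ p : g, L p = K p := fun _ => rfl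
  have : CompleteSpace g := (isClosed_of_adjoint_eq hg).completeSpace_coe
  have hclosed : IsClosed (Set.range L) := by
    -- The two entries bound `u` and `w` in terms of `w + W u - iM u`, for the max norm on the graph.
    set c : ℝ := max (M - ‖W‖)⁻¹ (1 + (‖W‖ + M) * (M - ‖W‖)⁻¹) with hcdef
    have hc0 : 0 ≤ c := (inv_nonneg.2 hc.le).trans (le_max_left _ _)
    refine (L.antilipschitz_of_bound (K := ⟨c, hc0⟩) ?_).isClosed_range L.uniformContinuous
    rintro ⟨⟨u, w⟩, h⟩
    rw [hLK, hK]
    change max ‖u‖ ‖w‖ ≤ c * ‖w + W u - (M * Complex.I) • u‖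
    set r := w + W u - (M * Complex.I) • u with hr
    have hu : ‖u‖ ≤ (M - ‖W‖)⁻¹ * ‖r‖ := by
      have := mul_norm_le_norm_add_sub hg W h M
      rw [abs_of_pos hM0] at this
      rwa [inv_mul_eq_div, le_div_iff₀' hc]
    have hw : ‖w‖ ≤ ‖r‖ + (‖W‖ + M) * ‖u‖ := by
      have e : w = r - W u + (M * Complex.I) • u := by rw [hr]; abel
      have h1 : ‖(M * Complex.I) • u‖ = M * ‖u‖ := by
        rw [norm_smul]; simp [abs_of_pos hM0]
      calc ‖w‖ = ‖r - W u + (M * Complex.I) • u‖ := by rw [← e]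
        _ ≤ ‖r‖ + ‖W u‖ + M * ‖u‖ := (norm_add_le _ _).trans (by
            rw [h1]; gcongr; exact norm_sub_le _ _)
        _ ≤ _ := by linarith [W.le_opNorm u]
    refine max_le (hu.trans ?_) (hw.trans ?_)
    · gcongr; exact le_max_left _ _
    · calc ‖r‖ + (‖W‖ + M) * ‖u‖ ≤ ‖r‖ + (‖W‖ + M) * ((M - ‖W‖)⁻¹ * ‖r‖) := by gcongr
        _ = (1 + (‖W‖ + M) * (M - ‖W‖)⁻¹) * ‖r‖ := by ring
        _ ≤ c * ‖r‖ := by gcongr; exact le_max_right _ _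
  have htop : L.range = ⊤ := by
    have hcl : IsClosed (L.range : Set E) := hclosed
    have : CompleteSpace L.range := hcl.completeSpace_coe
    rw [← Submodule.orthogonal_eq_bot_iff, Submodule.eq_bot_iff]
    intro f hf
    -- A vector `f` orthogonal to the range lies in the domain, with `(T + W* + iM) f = 0`.
    have key : (f, -(ContinuousLinearMap.adjoint W f) - (M * Complex.I) • f) ∈ g := by
      rw [mem_iff_of_adjoint_eq hg]
      intro a b hab
      have h0 : ⟪b + W a - (M * Complex.I) • a, f⟫_ℂ = 0 :=
        (Submodule.mem_orthogonal _ _).1 hf _ ⟨⟨(a, b), hab⟩, hK _⟩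
      rw [inner_sub_left, inner_add_left, inner_smul_left] at h0
      rw [inner_sub_right, inner_neg_right, ContinuousLinearMap.adjoint_inner_right,
        inner_smul_right]
      simp only [map_mul, Complex.conj_ofReal, Complex.conj_I] at h0
      linear_combination h0
    have h1 := mul_norm_le_norm_add_sub hg (ContinuousLinearMap.adjoint W) key (-M)
    rw [abs_neg, abs_of_pos hM0, LinearIsometryEquiv.norm_map] at h1
    have h2 : -(ContinuousLinearMap.adjoint W f) - (M * Complex.I) • f
        + ContinuousLinearMap.adjoint W f - (((-M : ℝ) : ℂ) * Complex.I) • f = 0 := by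
      push_cast; module
    rw [h2, norm_zero] at h1
    exact norm_le_zero_iff.1 (nonpos_of_mul_nonpos_right h1 hc)
  obtain ⟨⟨⟨u, w⟩, h⟩, hp⟩ : f ∈ L.range := htop ▸ Submodule.mem_top
  exact ⟨u, w, h, by rw [← hp]; exact (hK (u, w)).symm⟩

end Relation

/-! ### Eigenspaces -/

section Eigenspaces

variable {E : Type*} [NormedAddCommGroup E] [InnerProductSpace ℂ E]

theorem isEigenvector_iff {T : E →ₗ.[ℂ] E} {z : ℂ} {u : E} :
    IsEigenvector T z u ↔ u ≠ 0 ∧ (u, z • u) ∈ T.graph := by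
  simp [IsEigenvector, LinearPMap.mem_graph_iff]

/-- The eigenspace of an unbounded operator `T` for `z`, the zero vector included. -/
def eigenspace (T : E →ₗ.[ℂ] E) (z : ℂ) : Submodule ℂ E :=
  T.graph.comap (LinearMap.prod LinearMap.id (z • LinearMap.id))

theorem mem_eigenspace {T : E →ₗ.[ℂ] E} {z : ℂ} {u : E} :
    u ∈ eigenspace T z ↔ (u, z • u) ∈ T.graph := Iff.rfl

theorem isClosed_eigenspace {T : E →ₗ.[ℂ] E} (hT : T.graph.adjoint = T.graph) (z : ℂ) :
    IsClosed (eigenspace T z : Set E) :=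
  (isClosed_of_adjoint_eq hT).preimage (by fun_prop : Continuous fun u : E => (u, z • u))

theorem inner_eq_zero_of_mem_eigenspace {T : E →ₗ.[ℂ] E} (hT : T.graph.adjoint = T.graph)
    {z z' : ℂ} (hz : z ≠ z') {u v : E} (hu : u ∈ eigenspace T z) (hv : v ∈ eigenspace T z') :
    ⟪u, v⟫_ℂ = 0 := by
  rcases eq_or_ne u 0 with rfl | h0
  · exact inner_zero_left _
  have hreal : (starRingEnd ℂ) z = z := by
    have h1 := inner_eq_of_adjoint_eq hT (mem_eigenspace.1 hu) (mem_eigenspace.1 hu)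
    rw [inner_smul_left, inner_smul_right] at h1
    exact mul_right_cancel₀ (inner_self_ne_zero.2 h0) h1
  have h2 := inner_eq_of_adjoint_eq hT (mem_eigenspace.1 hv) (mem_eigenspace.1 hu)
  rw [inner_smul_left, inner_smul_right, hreal] at h2
  by_contra h
  exact hz (mul_right_cancel₀ h h2)

/-- Hilbert bases of pairwise orthogonal complete subspaces unite to one orthonormal set. -/
theorem exists_orthonormal_subset_iUnion {ι : Type*} (V : ι → Submodule ℂ E)
    [∀ i, CompleteSpace (V i)] (hV : OrthogonalFamily ℂ (fun i => V i) fun i => (V i).subtypeₗᵢ) :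
    ∃ 𝒰 : Set E, Orthonormal ℂ (Subtype.val : 𝒰 → E) ∧ (∀ U ∈ 𝒰, ∃ i, U ∈ V i) ∧
      ∀ i, V i ≤ (Submodule.span ℂ 𝒰).topologicalClosure := by
  choose w b hb using fun i => exists_hilbertBasis ℂ (V i)
  have hon : Orthonormal ℂ fun a : Σ i, w i => ((b a.1 a.2 : V a.1) : E) :=
    hV.orthonormal_sigma_orthonormal fun i => (b i).orthonormal
  refine ⟨_, hon.toSubtypeRange, ?_, fun i => ?_⟩
  · rintro _ ⟨a, rfl⟩
    exact ⟨a.1, (b a.1 a.2).2⟩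
  · intro u hu
    have hsum := ((b i).hasSum_repr ⟨u, hu⟩).mapL (V i).subtypeL
    refine mem_closure_of_tendsto hsum (Filter.Eventually.of_forall fun s => ?_)
    refine Submodule.sum_mem _ fun j _ => ?_
    rw [map_smul]
    exact Submodule.smul_mem _ _ (Submodule.subset_span ⟨⟨i, j⟩, rfl⟩)

end Eigenspaces

section Channels

variable {E₁ E₂ : Type*} [NormedAddCommGroup E₁] [InnerProductSpace ℂ E₁]
  [NormedAddCommGroup E₂] [InnerProductSpace ℂ E₂]
  {A₁ : E₁ →ₗ.[ℂ] E₁} {A₂ : E₂ →ₗ.[ℂ] E₂} {B₁₂ : E₂ →L[ℂ] E₁} {B₂₁ : E₁ →L[ℂ] E₂}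
  {Q₂₁ : E₁ →L[ℂ] E₂} {Q₁₂ : E₂ →L[ℂ] E₁}

/-! ### Graphs of the Hamiltonians -/

theorem mem_graph_channelHamiltonian {u w : E₁} :
    (u, w) ∈ (channelHamiltonian A₁ B₁₂ Q₂₁).graph ↔ (u, w - B₁₂ (Q₂₁ u)) ∈ A₁.graph := by
  simp only [LinearPMap.mem_graph_iff]
  constructor
  · rintro ⟨y, rfl, rfl⟩
    exact ⟨y, rfl, (add_sub_cancel_right _ _).symm⟩
  · rintro ⟨y, rfl, h⟩
    exact ⟨y, rfl, (eq_sub_iff_add_eq.1 h)⟩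

theorem mem_graph_totalHamiltonian {U W : WithLp 2 (E₁ × E₂)} :
    (U, W) ∈ (totalHamiltonian A₁ A₂ B₁₂ B₂₁).graph ↔
      (U.fst, W.fst - B₁₂ U.snd) ∈ A₁.graph ∧ (U.snd, W.snd - B₂₁ U.fst) ∈ A₂.graph := by
  simp only [LinearPMap.mem_graph_iff]
  constructor
  · rintro ⟨y, rfl, rfl⟩
    exact ⟨⟨⟨_, y.2.1⟩, rfl, (add_sub_cancel_right _ _).symm⟩,
      ⟨⟨_, y.2.2⟩, rfl, (add_sub_cancel_left _ _).symm⟩⟩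
  · rintro ⟨⟨y₁, h₁, k₁⟩, ⟨y₂, h₂, k₂⟩⟩
    obtain ⟨y₁, m₁⟩ := y₁
    obtain ⟨y₂, m₂⟩ := y₂
    obtain rfl : y₁ = _ := h₁
    obtain rfl : y₂ = _ := h₂
    refine ⟨⟨U, m₁, m₂⟩, rfl, ?_⟩
    apply (WithLp.equiv 2 (E₁ × E₂)).injective
    exact Prod.ext (eq_sub_iff_add_eq.1 k₁) (eq_sub_iff_add_eq'.1 k₂)

theorem IsRiccatiSolution.mem_graph (h : IsRiccatiSolution A₁ A₂ B₁₂ B₂₁ Q₂₁) {u w : E₁}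
    (hu : (u, w) ∈ A₁.graph) : (Q₂₁ u, Q₂₁ w + Q₂₁ (B₁₂ (Q₂₁ u)) - B₂₁ u) ∈ A₂.graph := by
  obtain ⟨y, rfl, rfl⟩ := (LinearPMap.mem_graph_iff _).1 hu
  obtain ⟨hf, h⟩ := h y
  refine (LinearPMap.mem_graph_iff _).2 ⟨⟨_, hf⟩, rfl, ?_⟩
  simp only [← h]
  abel

theorem adjoint_graph_of_isSelfAdjoint {E : Type*} [NormedAddCommGroup E] [InnerProductSpace ℂ E]
    [CompleteSpace E] {A : E →ₗ.[ℂ] E} (hA : IsSelfAdjoint A) : A.graph.adjoint = A.graph := by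
  conv_rhs => rw [← LinearPMap.isSelfAdjoint_def.1 hA]
  exact (LinearPMap.adjoint_graph_eq_graph_adjoint hA.dense_domain).symm

/-- `channelHamiltonian A₁ B₁₂ Q₂₁ - iM` is onto for large `M`. -/
theorem exists_mem_graph_channelHamiltonian [CompleteSpace E₁]
    (hA₁ : A₁.graph.adjoint = A₁.graph) {M : ℝ} (hM : ‖B₁₂ ∘L Q₂₁‖ < M) (f : E₁) :
    ∃ u, (u, f + (M * Complex.I) • u) ∈ (channelHamiltonian A₁ B₁₂ Q₂₁).graph := by
  obtain ⟨u, w, h, rfl⟩ := exists_mem_add_sub_eq hA₁ _ hM f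
  refine ⟨u, mem_graph_channelHamiltonian.2 ?_⟩
  rwa [sub_add_cancel, ContinuousLinearMap.comp_apply, add_sub_cancel_right]

/-! ### The graph of a Riccati solution -/

/-- The graph of a bounded operator between the channels, as a subspace of the Hilbert space direct
sum. -/
def channelGraph (Q : E₁ →L[ℂ] E₂) : Submodule ℂ (WithLp 2 (E₁ × E₂)) :=
  (WithLp.sndL 2 ℂ E₁ E₂ - Q ∘L WithLp.fstL 2 ℂ E₁ E₂).ker

theorem mem_channelGraph {Q : E₁ →L[ℂ] E₂} {U : WithLp 2 (E₁ × E₂)} :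
    U ∈ channelGraph Q ↔ U.snd = Q U.fst := by
  rw [channelGraph, LinearMap.mem_ker]
  exact sub_eq_zero

theorem isClosed_channelGraph (Q : E₁ →L[ℂ] E₂) :
    IsClosed (channelGraph Q : Set (WithLp 2 (E₁ × E₂))) :=
  ContinuousLinearMap.isClosed_ker _

/-- The graph of a Riccati solution is invariant under the total Hamiltonian, which acts on it as
the channel Hamiltonian. -/
theorem IsRiccatiSolution.mem_graph_total (h : IsRiccatiSolution A₁ A₂ B₁₂ B₂₁ Q₂₁) {u w : E₁}
    (hu : (u, w) ∈ (channelHamiltonian A₁ B₁₂ Q₂₁).graph) :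
    (WithLp.toLp 2 (u, Q₂₁ u), WithLp.toLp 2 (w, Q₂₁ w)) ∈
      (totalHamiltonian A₁ A₂ B₁₂ B₂₁).graph := by
  rw [mem_graph_channelHamiltonian] at hu
  refine mem_graph_totalHamiltonian.2 ⟨hu, ?_⟩
  simpa [-LinearPMap.mem_graph_iff] using h.mem_graph hu

/-- The transposed form of `IsRiccatiSolution.mem_graph_total`, for a Riccati solution from the
second channel to the first. -/
theorem IsRiccatiSolution.mem_graph_total_swap (h : IsRiccatiSolution A₂ A₁ B₂₁ B₁₂ Q₁₂)
    {u w : E₂} (hu : (u, w) ∈ (channelHamiltonian A₂ B₂₁ Q₁₂).graph) :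
    (WithLp.toLp 2 (Q₁₂ u, u), WithLp.toLp 2 (Q₁₂ w, w)) ∈
      (totalHamiltonian A₁ A₂ B₁₂ B₂₁).graph := by
  rw [mem_graph_channelHamiltonian] at hu
  refine mem_graph_totalHamiltonian.2 ⟨?_, hu⟩
  simpa [-LinearPMap.mem_graph_iff] using h.mem_graph hu

theorem isEigenvector_channel_of_mem_graph {z : ℂ} {U : WithLp 2 (E₁ × E₂)}
    (hU : IsEigenvector (totalHamiltonian A₁ A₂ B₁₂ B₂₁) z U) (h : U.snd = Q₂₁ U.fst) :
    IsEigenvector (channelHamiltonian A₁ B₁₂ Q₂₁) z U.fst := by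
  rw [isEigenvector_iff] at hU ⊢
  refine ⟨fun h0 => hU.1 ?_, mem_graph_channelHamiltonian.2 ?_⟩
  · apply (WithLp.equiv 2 (E₁ × E₂)).injective
    exact Prod.ext h0 (h.trans (by rw [h0, map_zero]; rfl))
  · rw [← h]
    exact (mem_graph_totalHamiltonian.1 hU.2).1

theorem isEigenvector_channel_of_mem_graph_swap {z : ℂ} {U : WithLp 2 (E₁ × E₂)}
    (hU : IsEigenvector (totalHamiltonian A₁ A₂ B₁₂ B₂₁) z U) (h : U.fst = Q₁₂ U.snd) :
    IsEigenvector (channelHamiltonian A₂ B₂₁ Q₁₂) z U.snd := by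
  rw [isEigenvector_iff] at hU ⊢
  refine ⟨fun h0 => hU.1 ?_, mem_graph_channelHamiltonian.2 ?_⟩
  · apply (WithLp.equiv 2 (E₁ × E₂)).injective
    exact Prod.ext (h.trans (by rw [h0, map_zero]; rfl)) h0
  · rw [← h]
    exact (mem_graph_totalHamiltonian.1 hU.2).2

theorem IsResolvent.not_isEigenvector {E : Type*} [NormedAddCommGroup E] [NormedSpace ℂ E]
    {T : E →ₗ.[ℂ] E} {z : ℂ} {R : E →L[ℂ] E} (h : IsResolvent T z R) (u : E) :
    ¬ IsEigenvector T z u := by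
  rintro ⟨h0, hu, he⟩
  have := h.2 ⟨u, hu⟩
  rw [he, sub_self, map_zero] at this
  exact h0 this.symm

/-- If `u₁` is an eigenvector of `H₁`, then `(u₁, u₂)` lies on the graph of `Q₂₁`: otherwise
`u₂ - Q₂₁ u₁` is an eigenvector of `A₂`, so that the eigenvalue is in the spectrum of `A₂`, where
`H₁ - z` is invertible. -/
theorem IsRiccatiSolution.snd_eq_of_isEigenvector (h : IsRiccatiSolution A₁ A₂ B₁₂ B₂₁ Q₂₁)
    (hres : ResolventBound (channelHamiltonian A₁ B₁₂ Q₂₁) (unboundedSpectrum A₂))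
    {z : ℂ} {u₁ : E₁} {u₂ : E₂} (hu₁ : IsEigenvector (channelHamiltonian A₁ B₁₂ Q₂₁) z u₁)
    (hu₂ : (u₂, z • u₂ - B₂₁ u₁) ∈ A₂.graph) : u₂ = Q₂₁ u₁ := by
  by_contra hne
  have hy : (u₂ - Q₂₁ u₁, z • (u₂ - Q₂₁ u₁)) ∈ A₂.graph := by
    have h1 := h.mem_graph (mem_graph_channelHamiltonian.1 (isEigenvector_iff.1 hu₁).2)
    have h2 := A₂.graph.sub_mem hu₂ h1
    rw [Prod.mk_sub_mk] at h2
    convert h2 using 2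
    simp only [map_sub, map_smul]
    module
  have hev : IsEigenvector A₂ z (u₂ - Q₂₁ u₁) := isEigenvector_iff.2 ⟨sub_ne_zero.2 hne, hy⟩
  obtain ⟨C, -, hC⟩ := hres
  obtain ⟨R, hR, -⟩ := hC z fun ⟨R, hR⟩ => hR.not_isEigenvector _ hev
  exact hR.not_isEigenvector _ hu₁

/-! ### Self-adjointness and reducing subspaces -/

variable [CompleteSpace E₁] [CompleteSpace E₂]

theorem adjoint_graph_totalHamiltonian (hA₁ : A₁.graph.adjoint = A₁.graph)
    (hA₂ : A₂.graph.adjoint = A₂.graph) (hB : B₂₁ = ContinuousLinearMap.adjoint B₁₂) :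
    (totalHamiltonian A₁ A₂ B₁₂ B₂₁).graph.adjoint = (totalHamiltonian A₁ A₂ B₁₂ B₂₁).graph := by
  ext ⟨U, W⟩
  simp only [Submodule.mem_adjoint_iff, sub_eq_zero]
  rw [mem_graph_totalHamiltonian]
  constructor
  · intro h
    rw [mem_iff_of_adjoint_eq hA₁, mem_iff_of_adjoint_eq hA₂]
    constructor
    · intro a b hab
      have h0₂ : ((0 : E₂), B₂₁ a - B₂₁ a) ∈ A₂.graph := by
        rw [sub_self]
        exact A₂.graph.zero_mem
      have := h (WithLp.toLp 2 (a, 0)) (WithLp.toLp 2 (b, B₂₁ a))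
        (mem_graph_totalHamiltonian.2 ⟨by simpa [-LinearPMap.mem_graph_iff] using hab, h0₂⟩)
      simp only [WithLp.prod_inner_apply, inner_zero_left, add_zero] at this
      rw [inner_sub_right, ← ContinuousLinearMap.adjoint_inner_left, ← hB]
      exact eq_sub_of_add_eq this
    · intro a b hab
      have h0₁ : ((0 : E₁), B₁₂ a - B₁₂ a) ∈ A₁.graph := by
        rw [sub_self]
        exact A₁.graph.zero_mem
      have := h (WithLp.toLp 2 (0, a)) (WithLp.toLp 2 (B₁₂ a, b))
        (mem_graph_totalHamiltonian.2 ⟨h0₁, by simpa [-LinearPMap.mem_graph_iff] using hab⟩)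
      simp only [WithLp.prod_inner_apply, inner_zero_left, zero_add] at this
      rw [inner_sub_right, hB, ContinuousLinearMap.adjoint_inner_right]
      exact eq_sub_of_add_eq' this
  · rintro ⟨h₁, h₂⟩ a b hab
    obtain ⟨k₁, k₂⟩ := mem_graph_totalHamiltonian.1 hab
    have e₁ := inner_eq_of_adjoint_eq hA₁ h₁ k₁
    have e₂ := inner_eq_of_adjoint_eq hA₂ h₂ k₂
    rw [inner_sub_left, inner_sub_right] at e₁ e₂
    rw [hB, ContinuousLinearMap.adjoint_inner_left, ContinuousLinearMap.adjoint_inner_right] at e₂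
    change ⟪b.fst, U.fst⟫_ℂ + ⟪b.snd, U.snd⟫_ℂ = ⟪a.fst, W.fst⟫_ℂ + ⟪a.snd, W.snd⟫_ℂ
    linear_combination e₁ + e₂

/-- Taking adjoints in the Riccati equation for `Q₂₁` gives the one for `Q₁₂ = -Q₂₁*`. That `Q₁₂`
maps `D(A₂)` into `D(A₁)` is where self-adjointness of `A₁`, not just symmetry, enters. -/
theorem IsRiccatiSolution.dual (hA₁ : A₁.graph.adjoint = A₁.graph)
    (hA₂ : A₂.graph.adjoint = A₂.graph) (hB : B₂₁ = ContinuousLinearMap.adjoint B₁₂)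
    (hQ : Q₁₂ = -ContinuousLinearMap.adjoint Q₂₁)
    (h : IsRiccatiSolution A₁ A₂ B₁₂ B₂₁ Q₂₁) :
    IsRiccatiSolution A₂ A₁ B₂₁ B₁₂ Q₁₂ := by
  rintro v
  have hmem : (Q₁₂ v, Q₁₂ (A₂ v) + Q₁₂ (B₂₁ (Q₁₂ v)) - B₁₂ v) ∈ A₁.graph := by
    rw [mem_iff_of_adjoint_eq hA₁]
    intro a b hab
    have := inner_eq_of_adjoint_eq hA₂ (A₂.mem_graph v) (h.mem_graph hab)
    simp only [inner_sub_left, inner_add_left] at this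
    simp only [hQ, hB, inner_sub_right, inner_add_right, inner_neg_right, neg_apply,
      ContinuousLinearMap.adjoint_inner_right, map_neg] at this ⊢
    rw [ContinuousLinearMap.adjoint_inner_left] at this
    linear_combination -this
  obtain ⟨y, hy, hw⟩ := (LinearPMap.mem_graph_iff _).1 hmem
  obtain ⟨y, m⟩ := y
  obtain rfl : y = _ := hy
  refine ⟨m, ?_⟩
  simp only [hw]
  abel

theorem mem_channelGraph_orthogonal {Q : E₁ →L[ℂ] E₂} {U : WithLp 2 (E₁ × E₂)} :
    U ∈ (channelGraph Q)ᗮ ↔ U.fst = -ContinuousLinearMap.adjoint Q U.snd := by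
  rw [Submodule.mem_orthogonal, ← add_eq_zero_iff_eq_neg]
  have key : ∀ x, ⟪x, U.fst⟫_ℂ + ⟪Q x, U.snd⟫_ℂ
      = ⟪x, U.fst + ContinuousLinearMap.adjoint Q U.snd⟫_ℂ := fun x => by
    rw [inner_add_right, ContinuousLinearMap.adjoint_inner_right]
  constructor
  · intro h
    refine ext_inner_left ℂ fun x => ?_
    rw [← key, inner_zero_right]
    exact h (WithLp.toLp 2 (x, Q x)) (mem_channelGraph.2 rfl)
  · intro h V hV
    change ⟪V.fst, U.fst⟫_ℂ + ⟪V.snd, U.snd⟫_ℂ = 0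
    rw [mem_channelGraph.1 hV, key, h, inner_zero_right]

/-- The graph of `Q₂₁` and its orthogonal complement reduce the eigenspaces of the total
Hamiltonian. The point is that both components of an eigenvector `U` lie in the domain: since
`H₁ - iM` and `H₂ - iM` are onto, `U` has a preimage under the total Hamiltonian minus `iM` that is
split in this way, and by injectivity this preimage is a multiple of `U`. -/
theorem IsRiccatiSolution.exists_add_eq_of_mem_eigenspace (hA₁ : A₁.graph.adjoint = A₁.graph)
    (hA₂ : A₂.graph.adjoint = A₂.graph) (hB : B₂₁ = ContinuousLinearMap.adjoint B₁₂)
    (hQ : Q₁₂ = -ContinuousLinearMap.adjoint Q₂₁)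
    (h : IsRiccatiSolution A₁ A₂ B₁₂ B₂₁ Q₂₁) {z : ℂ} {U : WithLp 2 (E₁ × E₂)}
    (hU : U ∈ eigenspace (totalHamiltonian A₁ A₂ B₁₂ B₂₁) z) :
    ∃ V ∈ eigenspace (totalHamiltonian A₁ A₂ B₁₂ B₂₁) z ⊓ channelGraph Q₂₁,
      ∃ V' ∈ eigenspace (totalHamiltonian A₁ A₂ B₁₂ B₂₁) z ⊓ (channelGraph Q₂₁)ᗮ, V + V' = U := by
  set T := totalHamiltonian A₁ A₂ B₁₂ B₂₁ with hT
  set M : ℝ := ‖B₁₂ ∘L Q₂₁‖ + ‖B₂₁ ∘L Q₁₂‖ + 1 with hM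
  have hM₁ : ‖B₁₂ ∘L Q₂₁‖ < M := by rw [hM]; linarith [norm_nonneg (B₂₁ ∘L Q₁₂)]
  have hM₂ : ‖B₂₁ ∘L Q₁₂‖ < M := by rw [hM]; linarith [norm_nonneg (B₁₂ ∘L Q₂₁)]
  have hM0 : 0 < M := (norm_nonneg _).trans_lt hM₁
  set c : ℂ := M * Complex.I with hc
  have : CompleteSpace (channelGraph Q₂₁) := (isClosed_channelGraph Q₂₁).completeSpace_coe
  obtain ⟨X, hX, Y, hY, hXY⟩ := (channelGraph Q₂₁).exists_add_mem_mem_orthogonal U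
  obtain ⟨x, hx⟩ := exists_mem_graph_channelHamiltonian hA₁ hM₁ X.fst
  obtain ⟨y, hy⟩ := exists_mem_graph_channelHamiltonian hA₂ hM₂ Y.snd
  have hX2 := mem_channelGraph.1 hX
  have hY1 : Y.fst = Q₁₂ Y.snd := by rw [hQ]; exact mem_channelGraph_orthogonal.1 hY
  set X' : WithLp 2 (E₁ × E₂) := WithLp.toLp 2 (x, Q₂₁ x) with hX'
  set Y' : WithLp 2 (E₁ × E₂) := WithLp.toLp 2 (Q₁₂ y, y) with hY'
  have gX : (X', X + c • X') ∈ T.graph := by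
    convert h.mem_graph_total hx using 2
    apply (WithLp.equiv 2 (E₁ × E₂)).injective
    refine Prod.ext rfl ?_
    change X.snd + c • Q₂₁ x = Q₂₁ (X.fst + c • x)
    rw [hX2, map_add, map_smul]
  have gY : (Y', Y + c • Y') ∈ T.graph := by
    convert (h.dual hA₁ hA₂ hB hQ).mem_graph_total_swap hy using 2
    apply (WithLp.equiv 2 (E₁ × E₂)).injective
    refine Prod.ext ?_ rfl
    change Y.fst + c • Q₁₂ y = Q₁₂ (Y.snd + c • y)
    rw [hY1, map_add, map_smul]
  have mX' : X' ∈ channelGraph Q₂₁ := mem_channelGraph.2 rfl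
  have mY' : Y' ∈ (channelGraph Q₂₁)ᗮ := by
    rw [mem_channelGraph_orthogonal, hY', hQ]
    rfl
  -- `X' + Y'` is the preimage of `U`; the difference below is in the kernel of the total
  -- Hamiltonian minus `iM`.
  have hdiff : ((z - c) • (X' + Y') - U, c • ((z - c) • (X' + Y') - U)) ∈ T.graph := by
    have h1 := T.graph.sub_mem (T.graph.smul_mem (z - c) (T.graph.add_mem gX gY)) hU
    convert h1 using 1
    refine Prod.ext rfl ?_
    change c • ((z - c) • (X' + Y') - U) = (z - c) • (X + c • X' + (Y + c • Y')) - z • U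
    rw [hXY]
    module
  have hUeq : (z - c) • (X' + Y') = U := by
    have h1 := mul_norm_le_norm_sub (adjoint_graph_totalHamiltonian hA₁ hA₂ hB) hdiff M
    rw [← hc, sub_self, norm_zero, abs_of_pos hM0] at h1
    exact sub_eq_zero.1 (norm_le_zero_iff.1 (nonpos_of_mul_nonpos_right h1 hM0))
  have hXeq : X = (z - c) • X' := by
    have e : X - (z - c) • X' = (z - c) • Y' - Y := by
      rw [sub_eq_sub_iff_add_eq_add, ← hXY, ← hUeq]
      module
    refine sub_eq_zero.1 ((Submodule.mem_bot ℂ).1 ?_)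
    rw [← (channelGraph Q₂₁).inf_orthogonal_eq_bot]
    exact ⟨Submodule.sub_mem _ hX (Submodule.smul_mem _ _ mX'),
      e ▸ Submodule.sub_mem _ (Submodule.smul_mem _ _ mY') hY⟩
  have hYeq : Y = (z - c) • Y' := by
    rw [← add_right_inj X, ← hXY, ← hUeq, hXeq, smul_add]
  have eig : ∀ {W W' : WithLp 2 (E₁ × E₂)}, W = (z - c) • W' → (W', W + c • W') ∈ T.graph →
      W ∈ eigenspace T z := by
    rintro W W' rfl hW
    refine Submodule.smul_mem _ _ (mem_eigenspace.2 ?_)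
    rwa [← add_smul, sub_add_cancel] at hW
  exact ⟨X, ⟨eig hXeq gX, hX⟩, Y, ⟨eig hYeq gY, hY⟩, hXY.symm⟩

end Channels

end TwoChannel

theorem mainTheorem4
    {E₁ E₂ : Type*}
    [NormedAddCommGroup E₁] [InnerProductSpace ℂ E₁] [CompleteSpace E₁]
    [NormedAddCommGroup E₂] [InnerProductSpace ℂ E₂] [CompleteSpace E₂]
    (A₁ : E₁ →ₗ.[ℂ] E₁) (hA₁ : IsSelfAdjoint A₁)
    (A₂ : E₂ →ₗ.[ℂ] E₂) (hA₂ : IsSelfAdjoint A₂)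
    (B₁₂ : E₂ →L[ℂ] E₁) (B₂₁ : E₁ →L[ℂ] E₂) (hB : B₂₁ = ContinuousLinearMap.adjoint B₁₂)
    (Q₂₁ : E₁ →L[ℂ] E₂) (Q₁₂ : E₂ →L[ℂ] E₁) (hQ : Q₁₂ = -ContinuousLinearMap.adjoint Q₂₁)
    (hRiccati : TwoChannel.IsRiccatiSolution A₁ A₂ B₁₂ B₂₁ Q₂₁)
    (Htot : WithLp 2 (E₁ × E₂) →ₗ.[ℂ] WithLp 2 (E₁ × E₂))
    (hHtot : Htot = TwoChannel.totalHamiltonian A₁ A₂ B₁₂ B₂₁)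
    (H₁ : E₁ →ₗ.[ℂ] E₁) (hH₁ : H₁ = TwoChannel.channelHamiltonian A₁ B₁₂ Q₂₁)
    (H₂ : E₂ →ₗ.[ℂ] E₂) (hH₂ : H₂ = TwoChannel.channelHamiltonian A₂ B₂₁ Q₁₂)
    (hres₁ : TwoChannel.ResolventBound H₁ (TwoChannel.unboundedSpectrum A₂))
    (hres₂ : TwoChannel.ResolventBound H₂ (TwoChannel.unboundedSpectrum A₁)) :
    (∀ (z : ℂ) (U : WithLp 2 (E₁ × E₂)), TwoChannel.IsEigenvector Htot z U →
      (TwoChannel.IsEigenvector H₁ z U.fst → ¬ TwoChannel.IsEigenvector H₂ z U.snd) ∧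
      (TwoChannel.IsEigenvector H₂ z U.snd → ¬ TwoChannel.IsEigenvector H₁ z U.fst)) ∧
    Disjoint (TwoChannel.eigenvectorSet₁ Htot H₁) (TwoChannel.eigenvectorSet₂ Htot H₂) ∧
    (∃ 𝒰 : Set (WithLp 2 (E₁ × E₂)), TwoChannel.IsCompleteEigensystem Htot 𝒰 ∧
      𝒰 ⊆ TwoChannel.eigenvectorSet₁ Htot H₁ ∪ TwoChannel.eigenvectorSet₂ Htot H₂) ∧
    (∀ (z : ℂ) (U : WithLp 2 (E₁ × E₂)), TwoChannel.IsEigenvector Htot z U →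
      z ∉ TwoChannel.eigenvalues H₁ ∩ TwoChannel.eigenvalues H₂ →
      U ∈ TwoChannel.eigenvectorSet₁ Htot H₁ ∪ TwoChannel.eigenvectorSet₂ Htot H₂) := by
  subst hHtot hH₁ hH₂
  have gA₁ := TwoChannel.adjoint_graph_of_isSelfAdjoint hA₁
  have gA₂ := TwoChannel.adjoint_graph_of_isSelfAdjoint hA₂
  have hdual := hRiccati.dual gA₁ gA₂ hB hQ
  set T := TwoChannel.totalHamiltonian A₁ A₂ B₁₂ B₂₁ with hT
  have gT : T.graph.adjoint = T.graph := TwoChannel.adjoint_graph_totalHamiltonian gA₁ gA₂ hB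
  set G := TwoChannel.channelGraph Q₂₁ with hG
  have hnot : ∀ (z : ℂ) (U : WithLp 2 (E₁ × E₂)), TwoChannel.IsEigenvector T z U →
      TwoChannel.IsEigenvector (TwoChannel.channelHamiltonian A₁ B₁₂ Q₂₁) z U.fst →
      ¬ TwoChannel.IsEigenvector (TwoChannel.channelHamiltonian A₂ B₂₁ Q₁₂) z U.snd := by
    intro z U hU h₁ h₂
    obtain ⟨hU0, hUz⟩ := TwoChannel.isEigenvector_iff.1 hU
    obtain ⟨k₁, k₂⟩ := TwoChannel.mem_graph_totalHamiltonian.1 hUz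
    have e₂ : U ∈ G :=
      TwoChannel.mem_channelGraph.2 (hRiccati.snd_eq_of_isEigenvector hres₁ h₁ k₂)
    have e₁ : U ∈ Gᗮ := by
      refine TwoChannel.mem_channelGraph_orthogonal.2 ?_
      rw [hdual.snd_eq_of_isEigenvector hres₂ h₂ k₁, hQ]
      rfl
    exact hU0 ((Submodule.mem_bot ℂ).1 (G.inf_orthogonal_eq_bot ▸ ⟨e₂, e₁⟩))
  have hmem₁ : ∀ {z : ℂ} {U : WithLp 2 (E₁ × E₂)}, U ≠ 0 → U ∈ TwoChannel.eigenspace T z ⊓ G →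
      TwoChannel.IsEigenvector T z U ∧
        TwoChannel.IsEigenvector (TwoChannel.channelHamiltonian A₁ B₁₂ Q₂₁) z U.fst := by
    intro z U h0 hU
    have hev : TwoChannel.IsEigenvector T z U := TwoChannel.isEigenvector_iff.2 ⟨h0, hU.1⟩
    exact ⟨hev, TwoChannel.isEigenvector_channel_of_mem_graph hev
      (TwoChannel.mem_channelGraph.1 hU.2)⟩
  have hmem₂ : ∀ {z : ℂ} {U : WithLp 2 (E₁ × E₂)}, U ≠ 0 → U ∈ TwoChannel.eigenspace T z ⊓ Gᗮ →
      TwoChannel.IsEigenvector T z U ∧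
        TwoChannel.IsEigenvector (TwoChannel.channelHamiltonian A₂ B₂₁ Q₁₂) z U.snd := by
    intro z U h0 hU
    have hev : TwoChannel.IsEigenvector T z U := TwoChannel.isEigenvector_iff.2 ⟨h0, hU.1⟩
    refine ⟨hev, TwoChannel.isEigenvector_channel_of_mem_graph_swap hev ?_⟩
    rw [hQ]
    exact TwoChannel.mem_channelGraph_orthogonal.1 hU.2
  have hsplit : ∀ {z : ℂ} {U : WithLp 2 (E₁ × E₂)}, TwoChannel.IsEigenvector T z U →
      ∃ V ∈ TwoChannel.eigenspace T z ⊓ G, ∃ V' ∈ TwoChannel.eigenspace T z ⊓ Gᗮ, V + V' = U :=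
    fun hU => hRiccati.exists_add_eq_of_mem_eigenspace gA₁ gA₂ hB hQ
      (TwoChannel.isEigenvector_iff.1 hU).2
  refine ⟨fun z U hU => ⟨hnot z U hU, fun h₂ h₁ => hnot z U hU h₁ h₂⟩, ?_, ?_, ?_⟩
  · rw [Set.disjoint_left]
    rintro U ⟨z, hU, h₁⟩ ⟨z', hU', h₂⟩
    obtain rfl : z = z' := by
      obtain ⟨h0, hz⟩ := TwoChannel.isEigenvector_iff.1 hU
      obtain ⟨-, hz'⟩ := TwoChannel.isEigenvector_iff.1 hU'
      exact smul_left_injective ℂ h0 (T.mem_graph_snd_inj hz hz' rfl)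
    exact hnot z U hU h₁ h₂
  · -- The Boolean index selects the part of the eigenspace in `G` or in `Gᗮ`.
    let V : ℂ × Bool → Submodule ℂ (WithLp 2 (E₁ × E₂)) := fun i =>
      TwoChannel.eigenspace T i.1 ⊓ bif i.2 then G else Gᗮ
    have hVcomplete : ∀ i, CompleteSpace (V i) := by
      rintro ⟨z, b⟩
      have hz := TwoChannel.isClosed_eigenspace gT z
      refine IsClosed.completeSpace_coe (hs := ?_)
      cases b
      · exact hz.inter G.isClosed_orthogonal
      · exact hz.inter (TwoChannel.isClosed_channelGraph Q₂₁)
    have hVorth : OrthogonalFamily ℂ (fun i => V i) fun i => (V i).subtypeₗᵢ := by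
      rintro ⟨z, b⟩ ⟨z', b'⟩ hne ⟨u, hu⟩ ⟨v, hv⟩
      change inner ℂ u v = 0
      rcases ne_or_eq z z' with hz | rfl
      · exact TwoChannel.inner_eq_zero_of_mem_eigenspace gT hz hu.1 hv.1
      · cases b <;> cases b'
        · exact absurd rfl hne
        · exact Submodule.inner_left_of_mem_orthogonal hv.2 hu.2
        · exact Submodule.inner_right_of_mem_orthogonal hu.2 hv.2
        · exact absurd rfl hne
    obtain ⟨𝒰, hon, hsub, hspan⟩ := TwoChannel.exists_orthonormal_subset_iUnion V hVorth
    have hcover : 𝒰 ⊆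
        TwoChannel.eigenvectorSet₁ T (TwoChannel.channelHamiltonian A₁ B₁₂ Q₂₁) ∪
          TwoChannel.eigenvectorSet₂ T (TwoChannel.channelHamiltonian A₂ B₂₁ Q₁₂) := by
      intro U hU
      have h0 : U ≠ 0 := hon.ne_zero ⟨U, hU⟩
      obtain ⟨⟨z, b⟩, hi⟩ := hsub U hU
      cases b
      · exact Or.inr ⟨z, hmem₂ h0 hi⟩
      · exact Or.inl ⟨z, hmem₁ h0 hi⟩
    refine ⟨𝒰, ⟨hon, fun U hU => ?_, fun z U hU => ?_⟩, hcover⟩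
    · rcases hcover hU with ⟨z, h, -⟩ | ⟨z, h, -⟩ <;> exact ⟨z, h⟩
    · obtain ⟨X, hX, Y, hY, rfl⟩ := hsplit hU
      exact Submodule.add_mem _ (hspan (z, true) hX) (hspan (z, false) hY)
  · intro z U hU hz
    obtain ⟨X, hX, Y, hY, rfl⟩ := hsplit hU
    rcases eq_or_ne X 0 with rfl | hX0
    · rw [zero_add] at hU ⊢
      exact Or.inr ⟨z, hmem₂ hU.1 hY⟩
    rcases eq_or_ne Y 0 with rfl | hY0
    · rw [add_zero] at hU ⊢
      exact Or.inl ⟨z, hmem₁ hU.1 hX⟩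
    exact absurd ⟨⟨_, (hmem₁ hX0 hX).2⟩, ⟨_, (hmem₂ hY0 hY).2⟩⟩ hz
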